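/- Let $d\ge 1$ and $n\ge 0$ be integers and let $\mathcal D_1,\mathcal D_2$ be compact sets (possibly of infinite cardinality) of density matrices on $\mathbb C^d$, that is, of positive semidefinite $d\times d$ complex matrices of trace $1$. For $i=1,2$ put $$\mathcal D_{i,n}=\{\rho^{\otimes n}:\rho\in\mathcal D_i\},\qquad \mathcal C_{i,n}=\operatorname{conv}(\mathcal D_{i,n}).$$ Let $F(\rho,\sigma)=\|\sqrt\rho\sqrt\sigma\|_1$, with $\|A\|_1=\operatorname{tr}\sqrt{A^\dagger A}$, be the (square-root) Uhlmann fidelity, let $F_{\max}=\sup_{\rho_1\in\mathcal D_1,\rho_2\in\mathcal D_2}F(\rho_1,\rho_2)$, and let $\dim_{\mathbb R}(\mathcal S)$ denote the real dimension of the smallest affine space containing a set $\mathcal S$ (with $\dim_{\mathbb R}(\emptyset)=0$ and $\sup\emptyset=0$ if some $\mathcal D_i$ is empty). Then both suprema below are finite and $$\sup_{\sigma_{1,n}\in\mathcal C_{1,n},\,\sigma_{2,n}\in\mathcal C_{2,n}}F(\sigma_{1,n},\sigma_{2,n})\le\Bigl(\max_{i=1,2}\dim_{\mathbb R}(\mathcal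 D_{i,n})+1\Bigr)F_{\max}^{\,n}.$$ Moreover, for each $i=1,2$, $$\dim_{\mathbb R}(\mathcal D_{i,n})+1\le\binom{n+d^2-1}{n},$$ and the binomial coefficient on the right is the real dimension of the space of Hermitian operators $A$ on $(\mathbb C^d)^{\otimes n}$ with $V(\pi)AV(\pi)^\dagger=A$ for every permutation $\pi$ of $\{1,\dots,n\}$, where $V(\pi)$ is the unitary permuting the $n$ tensor factors according to $\pi$. -/

import Mathlib

open scoped MatrixOrder ComplexOrder Matrix

noncomputable section

namespace CompositeQHT

/-- Density matrices on `ℂ^d`: positive semidefinite (hence Hermitian) matrices of unit trace. -/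
def densityMatrices (d : ℕ) : Set (Matrix (Fin d) (Fin d) ℂ) :=
  {ρ | ρ.PosSemidef ∧ ρ.trace = 1}

/-- The trace norm `‖A‖₁ = tr √(A† A)`; the trace is a nonnegative real number. -/
def traceNorm {ι : Type*} [Fintype ι] [DecidableEq ι] (A : Matrix ι ι ℂ) : ℝ :=
  (CFC.sqrt (Aᴴ * A)).trace.re

/-- The (square root) Uhlmann fidelity `F(ρ, σ) = ‖√ρ √σ‖₁`. -/
def fidelity {ι : Type*} [Fintype ι] [DecidableEq ι] (ρ σ : Matrix ι ι ℂ) : ℝ :=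
  traceNorm (CFC.sqrt ρ * CFC.sqrt σ)

/-- The values `F(ρ, σ)` for `ρ ∈ A` and `σ ∈ B`. -/
def fidelityValues {ι : Type*} [Fintype ι] [DecidableEq ι] (A B : Set (Matrix ι ι ℂ)) : Set ℝ :=
  Set.image2 fidelity A B

/-- The supremum of `F(ρ, σ)` over `ρ ∈ A` and `σ ∈ B`. -/
def supFidelity {ι : Type*} [Fintype ι] [DecidableEq ι] (A B : Set (Matrix ι ι ℂ)) : ℝ :=
  sSup (fidelityValues A B)

/-- The tensor power `ρ^{⊗n}` as a matrix on `(ℂ^d)^{⊗n}`, whose standard basis vectors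
`e_{i 0} ⊗ ⋯ ⊗ e_{i (n-1)}` are indexed by `i : Fin n → Fin d`. -/
def tensorPow {d : ℕ} (n : ℕ) (ρ : Matrix (Fin d) (Fin d) ℂ) :
    Matrix (Fin n → Fin d) (Fin n → Fin d) ℂ :=
  Matrix.of fun i j => ∏ k, ρ (i k) (j k)

/-- The set `{ρ^{⊗n} : ρ ∈ D}`. -/
def copies {d : ℕ} (n : ℕ) (D : Set (Matrix (Fin d) (Fin d) ℂ)) :
    Set (Matrix (Fin n → Fin d) (Fin n → Fin d) ℂ) :=
  tensorPow n '' D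

/-- The convex hull of `{ρ^{⊗n} : ρ ∈ D}`. -/
def hullCopies {d : ℕ} (n : ℕ) (D : Set (Matrix (Fin d) (Fin d) ℂ)) :
    Set (Matrix (Fin n → Fin d) (Fin n → Fin d) ℂ) :=
  convexHull ℝ (copies n D)

/-- The real dimension of the smallest affine space containing the set `S`. -/
def affineDim {ι : Type*} (S : Set (Matrix ι ι ℂ)) : ℕ :=
  Module.finrank ℝ (affineSpan ℝ S).direction

/-- The unitary `V(π)` on `(ℂ^d)^{⊗n}` permuting the tensor factors:
it sends `e_{j 0} ⊗ ⋯ ⊗ e_{j (n-1)}` to the basis vector indexed by `j ∘ π⁻¹`. -/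
def permOp (d n : ℕ) (π : Equiv.Perm (Fin n)) : Matrix (Fin n → Fin d) (Fin n → Fin d) ℂ :=
  Matrix.of fun i j => if i = j ∘ ⇑π⁻¹ then 1 else 0

/-- The real vector space of permutation-invariant Hermitian operators on `(ℂ^d)^{⊗n}`. -/
def permInvariant (d n : ℕ) : Submodule ℝ (Matrix (Fin n → Fin d) (Fin n → Fin d) ℂ) where
  carrier := {A | A.IsHermitian ∧ ∀ π : Equiv.Perm (Fin n),
    permOp d n π * A * (permOp d n π)ᴴ = A}
  zero_mem' := by simp
  add_mem' := by
    rintro A B ⟨hA, hA'⟩ ⟨hB, hB'⟩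
    exact ⟨hA.add hB, fun π => by rw [mul_add, add_mul, hA', hB']⟩
  smul_mem' := by
    rintro c A ⟨hA, hA'⟩
    refine ⟨?_, fun π => by rw [Matrix.mul_smul, Matrix.smul_mul, hA']⟩
    simp [Matrix.IsHermitian, Matrix.conjTranspose_smul, hA.eq]

end CompositeQHT

end

/-! For fixed `σ`, `F(ρ, σ) = tr √(√σ ρ √σ)` is subadditive in `ρ` (`trace_sqrt_sum_le`) and
homogeneous of degree 1/2. By Carathéodory a point of a convex hull is a mixture of `N ≤ dim + 1`
points, and `∑ √wᵢ ≤ √N`, so passing to the hull costs a factor `√(dim + 1)`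
(`fidelity_convexHull_left_le`). Doing this in both arguments costs at most `max dim + 1`, and on
the generators `F(ρ^{⊗n}, σ^{⊗n}) = F(ρ, σ)^n`.

Permutation-invariant Hermitian operators are counted by the orbits of index pairs, that is, by
multisets of size `n` in a set of `d²` elements. Differences of the `ρ^{⊗n}` lie in the traceless
ones, a proper subspace, which leaves room for the `+ 1`. -/

namespace CompositeQHT

/-! ### Square roots, pseudo-inverses and the trace norm. -/

section Sqrt

variable {ι : Type*} [Fintype ι]

theorem trace_re_nonneg {A : Matrix ι ι ℂ} (hA : A.PosSemidef) : 0 ≤ A.trace.re :=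
  (Complex.le_def.1 hA.trace_nonneg).1

theorem trace_eq_ofReal_re {A : Matrix ι ι ℂ} (hA : A.PosSemidef) :
    A.trace = (A.trace.re : ℂ) :=
  Complex.ext rfl (Complex.le_def.1 hA.trace_nonneg).2.symm

/-- The arithmetic-geometric mean inequality for the Hilbert-Schmidt inner product. -/
theorem two_mul_re_trace_conjTranspose_mul_le (A B : Matrix ι ι ℂ) :
    2 * (Aᴴ * B).trace.re ≤ (Aᴴ * A).trace.re + (Bᴴ * B).trace.re := by
  have h := trace_re_nonneg (Matrix.posSemidef_conjTranspose_mul_self (A - B))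
  have h' : (Bᴴ * A).trace.re = (Aᴴ * B).trace.re := by
    rw [← Complex.conj_re, ← Complex.star_def, ← Matrix.trace_conjTranspose,
      Matrix.conjTranspose_mul, Matrix.conjTranspose_conjTranspose]
  simp only [Matrix.conjTranspose_sub, sub_mul, mul_sub, Matrix.trace_sub, Complex.sub_re] at h
  linarith

variable [DecidableEq ι]

theorem posSemidef_sqrt (A : Matrix ι ι ℂ) : (CFC.sqrt A).PosSemidef :=
  Matrix.nonneg_iff_posSemidef.1 (CFC.sqrt_nonneg A)

theorem sqrt_mul_sqrt {A : Matrix ι ι ℂ} (hA : A.PosSemidef) : CFC.sqrt A * CFC.sqrt A = A :=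
  CFC.sqrt_mul_sqrt_self A hA.nonneg

theorem sqrt_eq_of_mul_self {A B : Matrix ι ι ℂ} (hB : B.PosSemidef) (h : B * B = A) :
    CFC.sqrt A = B :=
  CFC.sqrt_unique h hB.nonneg

theorem trace_mul_re_nonneg {A B : Matrix ι ι ℂ} (hA : A.PosSemidef) (hB : B.PosSemidef) :
    0 ≤ (A * B).trace.re := by
  have h : (A * B).trace = ((CFC.sqrt B)ᴴ * A * CFC.sqrt B).trace := by
    rw [(posSemidef_sqrt B).1.eq, Matrix.trace_mul_cycle, sqrt_mul_sqrt hB, Matrix.trace_mul_comm]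
  rw [h]
  exact trace_re_nonneg (hA.conjTranspose_mul_mul_same _)

/-- A contraction does not increase the trace of a positive semidefinite matrix. -/
theorem re_trace_mul_le {K P : Matrix ι ι ℂ} (hP : P.PosSemidef)
    (hK : (1 - Kᴴ * K).PosSemidef) : (K * P).trace.re ≤ P.trace.re := by
  set R := CFC.sqrt P
  have hRR : R * R = P := sqrt_mul_sqrt hP
  have hRh : Rᴴ = R := (posSemidef_sqrt P).1.eq
  have h := two_mul_re_trace_conjTranspose_mul_le R (K * R)
  have h1 : (Rᴴ * (K * R)).trace = (K * P).trace := by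
    rw [Matrix.trace_mul_comm, hRh, mul_assoc, hRR]
  have h2 : ((K * R)ᴴ * (K * R)).trace = (Kᴴ * K * P).trace := by
    rw [Matrix.conjTranspose_mul, hRh, mul_assoc, Matrix.trace_mul_comm, ← hRR]
    simp only [mul_assoc]
  have h3 := trace_mul_re_nonneg hK hP
  rw [sub_mul, one_mul, Matrix.trace_sub, Complex.sub_re] at h3
  rw [h1, h2, hRh, hRR] at h
  linarith

/-- The pseudo-inverse of a Hermitian matrix. -/
theorem exists_pseudoInverse {S : Matrix ι ι ℂ} (hS : S.IsHermitian) :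
    ∃ T : Matrix ι ι ℂ, T.IsHermitian ∧ S * T = T * S ∧ S * T * S = S ∧ T * S * T = T := by
  have hs : IsSelfAdjoint S := hS
  have hc (f : ℝ → ℝ) : ContinuousOn f (spectrum ℝ S) :=
    Matrix.finite_real_spectrum.continuousOn f
  have hid : cfc (fun x : ℝ => x) S = S := cfc_id' ℝ S
  have hm (f g : ℝ → ℝ) : cfc f S * cfc g S = cfc (fun x => f x * g x) S :=
    (cfc_mul f g S (hc f) (hc g)).symm
  -- The convention `0⁻¹ = 0` makes this the inverse on the range and zero on the kernel.
  refine ⟨cfc (fun x : ℝ => x⁻¹) S, cfc_predicate _ S, ?_, ?_, ?_⟩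
  · nth_rewrite 1 [← hid]
    nth_rewrite 4 [← hid]
    rw [hm, hm]
    simp only [mul_comm]
  · nth_rewrite 1 3 [← hid]
    rw [hm, hm]
    conv_rhs => rw [← hid]
    simp only [mul_inv_mul_cancel]
  · nth_rewrite 2 [← hid]
    rw [hm, hm]
    congr 1
    ext x
    by_cases hx : x = 0 <;> simp [hx]

theorem posSemidef_one_sub_of_projection {P : Matrix ι ι ℂ} (hP : P.IsHermitian)
    (h : P * P = P) : (1 - P).PosSemidef := by
  have := Matrix.posSemidef_conjTranspose_mul_self (1 - P)
  rwa [Matrix.conjTranspose_sub, Matrix.conjTranspose_one, hP.eq, sub_mul, mul_sub, mul_sub, h,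
    one_mul, one_mul, mul_one, sub_self, sub_zero] at this

/-- The trace of the square root is subadditive on positive semidefinite matrices. -/
theorem trace_sqrt_sum_le {κ : Type*} (s : Finset κ) {X : κ → Matrix ι ι ℂ}
    (hX : ∀ i, (X i).PosSemidef) :
    (CFC.sqrt (∑ i ∈ s, X i)).trace.re ≤ ∑ i ∈ s, (CFC.sqrt (X i)).trace.re := by
  classical
  set S := CFC.sqrt (∑ i ∈ s, X i)
  have hS : S.PosSemidef := posSemidef_sqrt _
  have hSS : S * S = ∑ i ∈ s, X i := sqrt_mul_sqrt (Matrix.posSemidef_sum s fun i _ => hX i)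
  obtain ⟨T, hT, hc, hSTS, hTST⟩ := exists_pseudoInverse hS.1
  have hP : (1 - T * S).PosSemidef := by
    refine posSemidef_one_sub_of_projection ?_ ?_
    · rw [Matrix.IsHermitian, Matrix.conjTranspose_mul, hT.eq, hS.1.eq, hc]
    · rw [← mul_assoc, hTST]
  have hsum : T * S = ∑ i ∈ s, T * X i * T := by
    rw [← Finset.sum_mul, ← Finset.mul_sum, ← hSS, ← mul_assoc, mul_assoc (T * S), hc,
      ← mul_assoc, hTST]
  -- `√Xᵢ T` is a contraction: its Gram matrix `T Xᵢ T` is one of the positive summands of the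
  -- projection `T S`.
  have hK (i) (hi : i ∈ s) : (1 - (CFC.sqrt (X i) * T)ᴴ * (CFC.sqrt (X i) * T)).PosSemidef := by
    have h1 : (CFC.sqrt (X i) * T)ᴴ * (CFC.sqrt (X i) * T) = T * X i * T := by
      rw [Matrix.conjTranspose_mul, hT.eq, (posSemidef_sqrt _).1.eq]
      nth_rewrite 3 [← sqrt_mul_sqrt (hX i)]
      simp only [mul_assoc]
    have h2 : 1 - T * X i * T = (1 - T * S) + ∑ j ∈ s.erase i, T * X j * T := by
      rw [hsum, ← Finset.add_sum_erase s _ hi]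
      abel
    rw [h1, h2]
    refine hP.add (Matrix.posSemidef_sum _ fun j _ => ?_)
    have := (hX j).conjTranspose_mul_mul_same T
    rwa [hT.eq] at this
  have htr : S.trace = ∑ i ∈ s, (CFC.sqrt (X i) * T * CFC.sqrt (X i)).trace := by
    have : S = T * ∑ i ∈ s, X i := by rw [← hSS, ← mul_assoc, ← hc, hSTS]
    rw [this, Finset.mul_sum, Matrix.trace_sum]
    refine Finset.sum_congr rfl fun i _ => ?_
    rw [Matrix.trace_mul_cycle, sqrt_mul_sqrt (hX i), Matrix.trace_mul_comm]
  rw [htr, Complex.re_sum]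
  exact Finset.sum_le_sum fun i hi => re_trace_mul_le (posSemidef_sqrt _) (hK i hi)

/-- With `T` the pseudo-inverse of `|A|`, one has `|A†| = A T A†`, and cyclicity of the trace gives
`tr |A†| = tr |A|`. -/
theorem traceNorm_conjTranspose (A : Matrix ι ι ℂ) : traceNorm Aᴴ = traceNorm A := by
  unfold traceNorm
  rw [Matrix.conjTranspose_conjTranspose]
  set S := CFC.sqrt (Aᴴ * A)
  have hS : S.PosSemidef := posSemidef_sqrt _
  have hSS : S * S = Aᴴ * A := sqrt_mul_sqrt (Matrix.posSemidef_conjTranspose_mul_self A)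
  obtain ⟨T, hT, hc, hSTS, hTST⟩ := exists_pseudoInverse hS.1
  have hA : A * (T * S) = A := by
    have h0 : S * (T * S) = S := by rw [← mul_assoc, hSTS]
    have h : (A * (T * S) - A)ᴴ * (A * (T * S) - A) = 0 := by
      have h1 : (A * (T * S) - A)ᴴ * (A * (T * S) - A)
          = (T * S - 1)ᴴ * (Aᴴ * A) * (T * S - 1) := by
        rw [show A * (T * S) - A = A * (T * S - 1) by rw [mul_sub, mul_one],
          Matrix.conjTranspose_mul]
        simp only [mul_assoc]
      rw [h1, ← hSS, mul_assoc, mul_assoc, mul_sub, h0, mul_one, sub_self, mul_zero, mul_zero]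
    exact sub_eq_zero.1 (Matrix.conjTranspose_mul_self_eq_zero.1 h)
  have hTpos : T.PosSemidef := by
    have := hS.conjTranspose_mul_mul_same T
    rwa [hT.eq, hTST] at this
  have hsq : CFC.sqrt (A * Aᴴ) = A * T * Aᴴ := by
    refine sqrt_eq_of_mul_self (hTpos.mul_mul_conjTranspose_same A) ?_
    calc A * T * Aᴴ * (A * T * Aᴴ) = A * (T * (Aᴴ * A) * T) * Aᴴ := by simp only [mul_assoc]
      _ = A * Aᴴ := by
        rw [← hSS, ← mul_assoc T, mul_assoc (T * S), hc, ← mul_assoc, hA, hA]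
  rw [hsq, Matrix.trace_mul_cycle, ← hSS, mul_assoc, hc, ← mul_assoc, hSTS]

theorem traceNorm_nonneg (A : Matrix ι ι ℂ) : 0 ≤ traceNorm A :=
  trace_re_nonneg (posSemidef_sqrt _)

/-- Polar decomposition: for `A = B† C` and the partial isometry `W = A T`, `tr |A| = tr ((B W)†
C)`. The arithmetic-geometric mean inequality and `W W† ≤ 1` finish. -/
theorem two_mul_traceNorm_conjTranspose_mul_le (B C : Matrix ι ι ℂ) :
    2 * traceNorm (Bᴴ * C) ≤ (B * Bᴴ).trace.re + (Cᴴ * C).trace.re := by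
  unfold traceNorm
  set A := Bᴴ * C with hAdef
  set S := CFC.sqrt (Aᴴ * A)
  have hS : S.PosSemidef := posSemidef_sqrt _
  have hSS : S * S = Aᴴ * A := sqrt_mul_sqrt (Matrix.posSemidef_conjTranspose_mul_self A)
  obtain ⟨T, hT, hc, hSTS, hTST⟩ := exists_pseudoInverse hS.1
  set W := A * T with hW
  have hWW : Wᴴ * W = T * S := by
    rw [hW, Matrix.conjTranspose_mul, hT.eq, mul_assoc, ← mul_assoc Aᴴ, ← hSS, mul_assoc, hc,
      ← mul_assoc, ← mul_assoc, hTST]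
  have hWP : W * (T * S) = W := by rw [hW, mul_assoc, ← hc, ← mul_assoc T, hTST]
  have hproj : (1 - W * Wᴴ).PosSemidef := by
    refine posSemidef_one_sub_of_projection (Matrix.isHermitian_mul_conjTranspose_self W) ?_
    rw [← mul_assoc, mul_assoc W, hWW, hWP]
  have htr : S.trace = ((B * W)ᴴ * C).trace := by
    rw [Matrix.conjTranspose_mul, mul_assoc, ← hAdef, hW, Matrix.conjTranspose_mul, hT.eq,
      mul_assoc, ← hSS, ← mul_assoc, ← hc, hSTS]
  have h := two_mul_re_trace_conjTranspose_mul_le (B * W) C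
  have h' : ((B * W)ᴴ * (B * W)).trace.re ≤ (B * Bᴴ).trace.re := by
    have h1 := trace_mul_re_nonneg hproj (Matrix.posSemidef_conjTranspose_mul_self B)
    rw [sub_mul, one_mul, Matrix.trace_sub, Complex.sub_re] at h1
    have h2 : ((B * W)ᴴ * (B * W)).trace = (W * Wᴴ * (Bᴴ * B)).trace := by
      rw [Matrix.conjTranspose_mul, ← mul_assoc, Matrix.trace_mul_comm]
      simp only [mul_assoc]
    rw [h2, Matrix.trace_mul_comm B]
    linarith
  rw [htr]
  linarith

end Sqrt

/-! ### Fidelity of mixtures and of convex hulls. -/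

section Fidelity

variable {ι : Type*} [Fintype ι] [DecidableEq ι]

theorem fidelity_nonneg (ρ σ : Matrix ι ι ℂ) : 0 ≤ fidelity ρ σ := traceNorm_nonneg _

theorem fidelity_comm (ρ σ : Matrix ι ι ℂ) : fidelity ρ σ = fidelity σ ρ := by
  rw [fidelity, ← traceNorm_conjTranspose, Matrix.conjTranspose_mul, (posSemidef_sqrt ρ).1.eq,
    (posSemidef_sqrt σ).1.eq, fidelity]

/-- In this form `ρ` enters linearly under the root. -/
theorem fidelity_eq {ρ : Matrix ι ι ℂ} (hρ : ρ.PosSemidef) (σ : Matrix ι ι ℂ) :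
    fidelity ρ σ = (CFC.sqrt ((CFC.sqrt σ)ᴴ * ρ * CFC.sqrt σ)).trace.re := by
  rw [fidelity, traceNorm, Matrix.conjTranspose_mul, (posSemidef_sqrt ρ).1.eq, mul_assoc,
    ← mul_assoc (CFC.sqrt ρ), sqrt_mul_sqrt hρ, mul_assoc]

theorem fidelity_sum_left_le {κ : Type*} (s : Finset κ) {ρ : κ → Matrix ι ι ℂ}
    (hρ : ∀ i, (ρ i).PosSemidef) (σ : Matrix ι ι ℂ) :
    fidelity (∑ i ∈ s, ρ i) σ ≤ ∑ i ∈ s, fidelity (ρ i) σ := by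
  rw [fidelity_eq (Matrix.posSemidef_sum s fun i _ => hρ i), Finset.mul_sum, Finset.sum_mul]
  simp only [fidelity_eq (hρ _)]
  exact trace_sqrt_sum_le s fun i => (hρ i).conjTranspose_mul_mul_same _

theorem fidelity_smul_left {c : ℝ} (hc : 0 ≤ c) {ρ : Matrix ι ι ℂ} (hρ : ρ.PosSemidef)
    (σ : Matrix ι ι ℂ) : fidelity (c • ρ) σ = √c * fidelity ρ σ := by
  have hsq : CFC.sqrt (c • ((CFC.sqrt σ)ᴴ * ρ * CFC.sqrt σ)) =
      √c • CFC.sqrt ((CFC.sqrt σ)ᴴ * ρ * CFC.sqrt σ) := by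
    refine sqrt_eq_of_mul_self ((posSemidef_sqrt _).smul (Real.sqrt_nonneg c)) ?_
    rw [smul_mul_smul_comm, Real.mul_self_sqrt hc,
      sqrt_mul_sqrt (hρ.conjTranspose_mul_mul_same _)]
  rw [fidelity_eq (hρ.smul hc), fidelity_eq hρ, Matrix.mul_smul, Matrix.smul_mul, hsq,
    Matrix.trace_smul, Complex.real_smul, Complex.re_ofReal_mul]

theorem fidelity_le_one {ρ σ : Matrix ι ι ℂ} (hρ : ρ.PosSemidef) (hρ1 : ρ.trace = 1)
    (hσ : σ.PosSemidef) (hσ1 : σ.trace = 1) : fidelity ρ σ ≤ 1 := by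
  have h := two_mul_traceNorm_conjTranspose_mul_le (CFC.sqrt ρ) (CFC.sqrt σ)
  rw [(posSemidef_sqrt ρ).1.eq, (posSemidef_sqrt σ).1.eq, sqrt_mul_sqrt hρ, sqrt_mul_sqrt hσ,
    hρ1, hσ1, Complex.one_re] at h
  rw [fidelity]
  linarith

theorem sum_sqrt_le_sqrt_card {κ : Type*} [Fintype κ] {w : κ → ℝ} (hw : ∀ i, 0 ≤ w i)
    (hw1 : ∑ i, w i = 1) : ∑ i, √(w i) ≤ √(Fintype.card κ) := by
  refine Real.le_sqrt_of_sq_le ?_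
  have := sq_sum_le_card_mul_sum_sq (s := Finset.univ) (f := fun i => √(w i))
  simpa [Real.sq_sqrt (hw _), hw1] using this

theorem fidelity_mixture_left_le {κ : Type*} [Fintype κ] {w : κ → ℝ}
    (hw : ∀ i, 0 ≤ w i) (hw1 : ∑ i, w i = 1) {ρ : κ → Matrix ι ι ℂ}
    (hρ : ∀ i, (ρ i).PosSemidef) {σ : Matrix ι ι ℂ} {m : ℝ} (hm0 : 0 ≤ m)
    (hm : ∀ i, fidelity (ρ i) σ ≤ m) :
    fidelity (∑ i, w i • ρ i) σ ≤ √(Fintype.card κ) * m :=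
  calc fidelity (∑ i, w i • ρ i) σ
      ≤ ∑ i, fidelity (w i • ρ i) σ :=
        fidelity_sum_left_le Finset.univ (fun i => (hρ i).smul (hw i)) σ
    _ = ∑ i, √(w i) * fidelity (ρ i) σ :=
        Finset.sum_congr rfl fun i _ => fidelity_smul_left (hw i) (hρ i) σ
    _ ≤ ∑ i, √(w i) * m :=
        Finset.sum_le_sum fun i _ => mul_le_mul_of_nonneg_left (hm i) (Real.sqrt_nonneg _)
    _ ≤ √(Fintype.card κ) * m := by
        rw [← Finset.sum_mul]
        exact mul_le_mul_of_nonneg_right (sum_sqrt_le_sqrt_card hw hw1) hm0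

/-- A bound for the fidelity extends from a set to its convex hull, up to a factor depending on
the dimension (by Carathéodory's theorem). -/
theorem fidelity_convexHull_left_le {A : Set (Matrix ι ι ℂ)} (hA : ∀ ρ ∈ A, ρ.PosSemidef)
    {σ : Matrix ι ι ℂ} {m : ℝ} (hm0 : 0 ≤ m) (hm : ∀ ρ ∈ A, fidelity ρ σ ≤ m)
    {ρ : Matrix ι ι ℂ} (hρ : ρ ∈ convexHull ℝ A) :
    fidelity ρ σ ≤ √(affineDim A + 1 : ℕ) * m := by
  obtain ⟨κ, _, z, w, hz, hind, hw, hw1, rfl⟩ := eq_pos_convex_span_of_mem_convexHull hρ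
  have hmem (i) : z i ∈ A := hz ⟨i, rfl⟩
  have hcard : Fintype.card κ ≤ affineDim A + 1 := by
    -- Carathéodory's points are affinely independent, so the dimension of their span bounds their
    -- number.
    refine hind.card_le_finrank_succ.trans (Nat.succ_le_succ ?_)
    rw [affineDim, direction_affineSpan]
    exact Submodule.finrank_mono (vectorSpan_mono ℝ hz)
  refine (fidelity_mixture_left_le (fun i => (hw i).le) hw1 (fun i => hA _ (hmem i)) hm0
    fun i => hm _ (hmem i)).trans (mul_le_mul_of_nonneg_right ?_ hm0)
  exact Real.sqrt_le_sqrt (Nat.cast_le.2 hcard)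

theorem fidelity_convexHull_le {A B : Set (Matrix ι ι ℂ)} (hA : ∀ ρ ∈ A, ρ.PosSemidef)
    (hB : ∀ σ ∈ B, σ.PosSemidef) {m : ℝ} (hm0 : 0 ≤ m)
    (hm : ∀ ρ ∈ A, ∀ σ ∈ B, fidelity ρ σ ≤ m) {ρ σ : Matrix ι ι ℂ}
    (hρ : ρ ∈ convexHull ℝ A) (hσ : σ ∈ convexHull ℝ B) :
    fidelity ρ σ ≤ ((max (affineDim A) (affineDim B) : ℕ) + 1 : ℝ) * m := by
  have h1 (ρ' : Matrix ι ι ℂ) (hρ' : ρ' ∈ A) :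
      fidelity ρ' σ ≤ √(affineDim B + 1 : ℕ) * m := by
    rw [fidelity_comm]
    exact fidelity_convexHull_left_le hB hm0
      (fun σ' hσ' => fidelity_comm ρ' σ' ▸ hm ρ' hρ' σ' hσ') hσ
  refine (fidelity_convexHull_left_le hA (by positivity) h1 hρ).trans ?_
  rw [← mul_assoc, ← Nat.cast_add_one]
  refine mul_le_mul_of_nonneg_right ?_ hm0
  -- Each of the two square roots, one per argument, is at most the root of the maximum plus one.
  rw [← Real.mul_self_sqrt (Nat.cast_nonneg (max (affineDim A) (affineDim B) + 1))]
  gcongr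
  · exact le_max_left _ _
  · exact le_max_right _ _

end Fidelity

end CompositeQHT

namespace CompositeQHT

/-! ### Dimension of the permutation-invariant Hermitian operators. -/

section PermInvariant

variable {d n : ℕ}

/-- The multiset of pairs of indices of a matrix entry on a tensor power. -/
def entryType (i j : Fin n → Fin d) : Sym (Fin d × Fin d) n :=
  ⟨Finset.univ.val.map fun k => (i k, j k), by simp⟩

theorem entryType_comp (i j : Fin n → Fin d) (π : Equiv.Perm (Fin n)) :
    entryType (i ∘ π) (j ∘ π) = entryType i j := by
  apply Subtype.ext
  simp only [entryType]
  conv_rhs => rw [← Multiset.map_univ_val_equiv π, Multiset.map_map]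
  rfl

theorem exists_entryType_eq (q : Sym (Fin d × Fin d) n) :
    ∃ i j : Fin n → Fin d, entryType i j = q := by
  obtain ⟨s, hs⟩ := q
  induction s using Quotient.inductionOn with
  | h l =>
    have hl : l.length = n := by simpa using hs
    subst hl
    refine ⟨fun k => (l.get k).1, fun k => (l.get k).2, Subtype.ext ?_⟩
    simp [entryType]

/-- Equal multisets mean fibres of equal size; bijections between the fibres glue to a permutation.
-/
theorem exists_perm_of_entryType_eq {i j i' j' : Fin n → Fin d}
    (h : entryType i j = entryType i' j') :
    ∃ π : Equiv.Perm (Fin n), i' = i ∘ π ∧ j' = j ∘ π := by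
  let f : Fin n → Fin d × Fin d := fun k => (i k, j k)
  let g : Fin n → Fin d × Fin d := fun k => (i' k, j' k)
  have hcard (c : Fin d × Fin d) : Fintype.card {k // g k = c} = Fintype.card {k // f k = c} := by
    have hc := congrArg (Multiset.count c) (congrArg Subtype.val h)
    simp only [entryType, Multiset.count_map] at hc
    simp only [Fintype.card_subtype, eq_comm (b := c)]
    exact hc.symm
  let π : Equiv.Perm (Fin n) := Equiv.ofFiberEquiv fun c => Fintype.equivOfCardEq (hcard c)
  have hπ (k) : f (π k) = g k := Equiv.ofFiberEquiv_map _ k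
  exact ⟨π, funext fun k => (congrArg Prod.fst (hπ k)).symm,
    funext fun k => (congrArg Prod.snd (hπ k)).symm⟩

theorem permOp_mul_mul_apply (π : Equiv.Perm (Fin n))
    (A : Matrix (Fin n → Fin d) (Fin n → Fin d) ℂ) (i j : Fin n → Fin d) :
    (permOp d n π * A * (permOp d n π)ᴴ) i j = A (i ∘ π) (j ∘ π) := by
  have h (i j : Fin n → Fin d) : i = j ∘ ⇑π⁻¹ ↔ i ∘ ⇑π = j := by
    constructor
    · rintro rfl; ext; simp
    · rintro rfl; ext; simp
  simp only [Matrix.mul_apply, permOp, Matrix.conjTranspose_apply, Matrix.of_apply, h]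
  simp

theorem mem_permInvariant {A : Matrix (Fin n → Fin d) (Fin n → Fin d) ℂ} :
    A ∈ permInvariant d n ↔
      A.IsHermitian ∧ ∀ (π : Equiv.Perm (Fin n)) (i j), A (i ∘ π) (j ∘ π) = A i j := by
  simp only [← permOp_mul_mul_apply]
  exact and_congr_right fun _ => forall_congr' fun π => Matrix.ext_iff.symm

/-- The linear map `A ↦ Re A + Im A` to real functions on the entry types: it is a coordinate
system on the permutation-invariant Hermitian operators. -/
noncomputable def permInvariantCoord (d n : ℕ) : permInvariant d n →ₗ[ℝ] (Sym (Fin d × Fin d) n → ℝ) where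
  toFun A q := (A.1 (exists_entryType_eq q).choose (exists_entryType_eq q).choose_spec.choose).re
    + (A.1 (exists_entryType_eq q).choose (exists_entryType_eq q).choose_spec.choose).im
  map_add' A B := by
    ext q
    simp
    ring
  map_smul' c A := by
    ext q
    simp
    ring

theorem permInvariantCoord_entryType (A : permInvariant d n) (i j : Fin n → Fin d) :
    permInvariantCoord d n A (entryType i j) = (A.1 i j).re + (A.1 i j).im := by
  obtain ⟨π, h1, h2⟩ := exists_perm_of_entryType_eq
    (exists_entryType_eq (entryType i j)).choose_spec.choose_spec
  have h := (mem_permInvariant.1 A.2).2 π (exists_entryType_eq (entryType i j)).choose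
    (exists_entryType_eq (entryType i j)).choose_spec.choose
  rw [← h1, ← h2] at h
  simp only [permInvariantCoord, LinearMap.coe_mk, AddHom.coe_mk]
  rw [← h]

theorem permInvariantCoord_bijective : Function.Bijective (permInvariantCoord d n) := by
  constructor
  · rw [injective_iff_map_eq_zero]
    intro A hA
    refine Subtype.ext (Matrix.ext fun i j => ?_)
    -- Swapping `i` and `j` conjugates the entry, so both `Re + Im` and `Re - Im` vanish.
    have h1 := permInvariantCoord_entryType A i j
    have h2 := permInvariantCoord_entryType A j i
    rw [hA, ← (mem_permInvariant.1 A.2).1.apply j i] at h2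
    rw [hA] at h1
    simp only [Pi.zero_apply, Complex.star_def, Complex.conj_re, Complex.conj_im] at h1 h2
    apply Complex.ext <;> simp <;> linarith
  · intro g
    -- The real part is the symmetric half of `g`, the imaginary part the antisymmetric half.
    let B : Matrix (Fin n → Fin d) (Fin n → Fin d) ℂ := Matrix.of fun i j =>
      ⟨(g (entryType i j) + g (entryType j i)) / 2, (g (entryType i j) - g (entryType j i)) / 2⟩
    have hB : B ∈ permInvariant d n := by
      refine mem_permInvariant.2 ⟨?_, fun π i j => ?_⟩
      · ext i j
        apply Complex.ext <;> simp [B] <;> ring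
      · simp [B, entryType_comp]
    refine ⟨⟨B, hB⟩, funext fun q => ?_⟩
    obtain ⟨i, j, rfl⟩ := exists_entryType_eq q
    rw [permInvariantCoord_entryType]
    simp [B]
    ring

theorem finrank_permInvariant (d n : ℕ) :
    Module.finrank ℝ (permInvariant d n) = (n + d ^ 2 - 1).choose n := by
  rw [(LinearEquiv.ofBijective _ permInvariantCoord_bijective).finrank_eq,
    Module.finrank_fintype_fun_eq_card, Sym.card_sym_eq_choose, Fintype.card_prod,
    Fintype.card_fin, ← sq, add_comm]

end PermInvariant

/-! ### Tensor powers and the dimension of their span. -/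

section TensorPow

variable {d : ℕ} (n : ℕ)

theorem tensorPow_mul (A B : Matrix (Fin d) (Fin d) ℂ) :
    tensorPow n (A * B) = tensorPow n A * tensorPow n B := by
  ext i j
  simp only [tensorPow, Matrix.of_apply, Matrix.mul_apply, ← Finset.prod_mul_distrib]
  rw [Finset.prod_univ_sum, Fintype.piFinset_univ]

theorem tensorPow_conjTranspose (A : Matrix (Fin d) (Fin d) ℂ) :
    tensorPow n Aᴴ = (tensorPow n A)ᴴ := by
  ext i j
  simp [tensorPow]

theorem trace_tensorPow (A : Matrix (Fin d) (Fin d) ℂ) :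
    (tensorPow n A).trace = A.trace ^ n := by
  simp only [tensorPow, Matrix.trace, Matrix.diag_apply, Matrix.of_apply]
  rw [← Fintype.piFinset_univ, ← Finset.prod_univ_sum (fun _ => Finset.univ) fun _ k => A k k]
  simp

theorem tensorPow_mem_permInvariant {A : Matrix (Fin d) (Fin d) ℂ} (hA : A.IsHermitian) :
    tensorPow n A ∈ permInvariant d n := by
  refine mem_permInvariant.2 ⟨?_, fun π i j => ?_⟩
  · rw [Matrix.IsHermitian, ← tensorPow_conjTranspose, hA.eq]
  · simp only [tensorPow, Matrix.of_apply, Function.comp_apply]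
    exact Equiv.prod_comp π fun k => A (i k) (j k)

theorem affineDim_copies_add_one_le (hd : 0 < d) {D : Set (Matrix (Fin d) (Fin d) ℂ)}
    (hD : D ⊆ densityMatrices d) :
    affineDim (copies n D) + 1 ≤ (n + d ^ 2 - 1).choose n := by
  rcases D.eq_empty_or_nonempty with rfl | ⟨ρ, hρ⟩
  · have h : affineDim (copies n (∅ : Set (Matrix (Fin d) (Fin d) ℂ))) = 0 := by
      rw [affineDim, copies, Set.image_empty, AffineSubspace.span_empty,
        AffineSubspace.direction_bot, finrank_bot]
    rw [h, zero_add]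
    -- Positivity of `d` keeps the truncated `n + d ^ 2 - 1` at least `n`.
    have : 0 < d ^ 2 := by positivity
    exact Nat.choose_pos (by omega)
  · have htr (σ) (hσ : σ ∈ D) : (tensorPow n σ).trace = 1 := by
      rw [trace_tensorPow, (hD hσ).2, one_pow]
    have hle : (affineSpan ℝ (copies n D)).direction ≤
        permInvariant d n ⊓ LinearMap.ker (Matrix.traceLinearMap (Fin n → Fin d) ℝ ℂ) := by
      rw [direction_affineSpan, vectorSpan_def, Submodule.span_le]
      rintro _ ⟨_, ⟨σ, hσ, rfl⟩, _, ⟨τ, hτ, rfl⟩, rfl⟩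
      refine ⟨Submodule.sub_mem _ (tensorPow_mem_permInvariant n (hD hσ).1.1)
        (tensorPow_mem_permInvariant n (hD hτ).1.1), ?_⟩
      simp [htr σ hσ, htr τ hτ]
    rw [← finrank_permInvariant, Nat.succ_le_iff]
    -- The inclusion is strict: `ρ^{⊗n}` is invariant but has trace 1, not 0.
    refine Submodule.finrank_lt_finrank_of_lt (lt_of_le_of_ne (hle.trans inf_le_left) fun h => ?_)
    have h1 := hle (h ▸ tensorPow_mem_permInvariant n (hD hρ).1.1)
    simpa [htr ρ hρ] using h1.2

end TensorPow

end CompositeQHT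

namespace CompositeQHT

/-! ### Multiplicativity of the fidelity and the final bound. -/

section FidelityTensorPow

variable {d : ℕ} (n : ℕ)

theorem posSemidef_tensorPow {A : Matrix (Fin d) (Fin d) ℂ} (hA : A.PosSemidef) :
    (tensorPow n A).PosSemidef := by
  rw [← sqrt_mul_sqrt hA, tensorPow_mul]
  nth_rewrite 1 [← (posSemidef_sqrt A).1.eq]
  rw [tensorPow_conjTranspose]
  exact Matrix.posSemidef_conjTranspose_mul_self _

theorem sqrt_tensorPow {A : Matrix (Fin d) (Fin d) ℂ} (hA : A.PosSemidef) :
    CFC.sqrt (tensorPow n A) = tensorPow n (CFC.sqrt A) :=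
  sqrt_eq_of_mul_self (posSemidef_tensorPow n (posSemidef_sqrt A)) (by
    rw [← tensorPow_mul, sqrt_mul_sqrt hA])

theorem traceNorm_tensorPow (A : Matrix (Fin d) (Fin d) ℂ) :
    traceNorm (tensorPow n A) = traceNorm A ^ n := by
  rw [traceNorm, traceNorm, ← tensorPow_conjTranspose, ← tensorPow_mul,
    sqrt_tensorPow n (Matrix.posSemidef_conjTranspose_mul_self A), trace_tensorPow,
    trace_eq_ofReal_re (posSemidef_sqrt _), ← Complex.ofReal_pow, Complex.ofReal_re,
    Complex.ofReal_re]

theorem fidelity_tensorPow {ρ σ : Matrix (Fin d) (Fin d) ℂ} (hρ : ρ.PosSemidef)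
    (hσ : σ.PosSemidef) : fidelity (tensorPow n ρ) (tensorPow n σ) = fidelity ρ σ ^ n := by
  rw [fidelity, sqrt_tensorPow n hρ, sqrt_tensorPow n hσ, ← tensorPow_mul, traceNorm_tensorPow,
    fidelity]

end FidelityTensorPow

theorem bddAbove_fidelityValues {d : ℕ} {D₁ D₂ : Set (Matrix (Fin d) (Fin d) ℂ)}
    (hD₁ : D₁ ⊆ densityMatrices d) (hD₂ : D₂ ⊆ densityMatrices d) :
    BddAbove (fidelityValues D₁ D₂) := by
  refine ⟨1, ?_⟩
  rintro _ ⟨ρ, hρ, σ, hσ, rfl⟩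
  exact fidelity_le_one (hD₁ hρ).1 (hD₁ hρ).2 (hD₂ hσ).1 (hD₂ hσ).2

theorem supFidelity_nonneg {ι : Type*} [Fintype ι] [DecidableEq ι] (A B : Set (Matrix ι ι ℂ)) :
    0 ≤ supFidelity A B := by
  refine Real.sSup_nonneg ?_
  rintro _ ⟨ρ, _, σ, _, rfl⟩
  exact fidelity_nonneg ρ σ

theorem fidelity_hullCopies_le {d n : ℕ} {D₁ D₂ : Set (Matrix (Fin d) (Fin d) ℂ)}
    (hD₁ : D₁ ⊆ densityMatrices d) (hD₂ : D₂ ⊆ densityMatrices d)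
    {ρ σ : Matrix (Fin n → Fin d) (Fin n → Fin d) ℂ}
    (hρ : ρ ∈ hullCopies n D₁) (hσ : σ ∈ hullCopies n D₂) :
    fidelity ρ σ ≤ ((max (affineDim (copies n D₁)) (affineDim (copies n D₂)) : ℕ) + 1 : ℝ) *
      supFidelity D₁ D₂ ^ n := by
  refine fidelity_convexHull_le ?_ ?_ (pow_nonneg (supFidelity_nonneg D₁ D₂) n) ?_ hρ hσ
  · rintro _ ⟨ρ, hρ, rfl⟩
    exact posSemidef_tensorPow n (hD₁ hρ).1
  · rintro _ ⟨σ, hσ, rfl⟩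
    exact posSemidef_tensorPow n (hD₂ hσ).1
  · rintro _ ⟨ρ, hρ, rfl⟩ _ ⟨σ, hσ, rfl⟩
    rw [fidelity_tensorPow n (hD₁ hρ).1 (hD₂ hσ).1]
    exact pow_le_pow_left₀ (fidelity_nonneg ρ σ)
      (le_csSup (bddAbove_fidelityValues hD₁ hD₂) ⟨ρ, hρ, σ, hσ, rfl⟩) n

end CompositeQHT

theorem mainTheorem9 (d n : ℕ) (hd : 0 < d)
    (D₁ D₂ : Set (Matrix (Fin d) (Fin d) ℂ))
    (hD₁ : D₁ ⊆ CompositeQHT.densityMatrices d) (hD₂ : D₂ ⊆ CompositeQHT.densityMatrices d)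
    (hc₁ : IsCompact D₁) (hc₂ : IsCompact D₂) :
    -- both suprema are finite
    BddAbove (CompositeQHT.fidelityValues D₁ D₂) ∧
    BddAbove (CompositeQHT.fidelityValues
      (CompositeQHT.hullCopies n D₁) (CompositeQHT.hullCopies n D₂)) ∧
    -- the bound on the fidelity between the convex hulls
    CompositeQHT.supFidelity (CompositeQHT.hullCopies n D₁) (CompositeQHT.hullCopies n D₂) ≤
      ((max (CompositeQHT.affineDim (CompositeQHT.copies n D₁))
          (CompositeQHT.affineDim (CompositeQHT.copies n D₂)) : ℕ) + 1 : ℝ) *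
        CompositeQHT.supFidelity D₁ D₂ ^ n ∧
    -- the bound on the dimensions
    CompositeQHT.affineDim (CompositeQHT.copies n D₁) + 1 ≤ (n + d ^ 2 - 1).choose n ∧
    CompositeQHT.affineDim (CompositeQHT.copies n D₂) + 1 ≤ (n + d ^ 2 - 1).choose n ∧
    -- the binomial coefficient is the dimension of the permutation-invariant Hermitian operators
    Module.finrank ℝ (CompositeQHT.permInvariant d n) = (n + d ^ 2 - 1).choose n := by
  have hF {x : ℝ} (hx : x ∈ CompositeQHT.fidelityValues
      (CompositeQHT.hullCopies n D₁) (CompositeQHT.hullCopies n D₂)) :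
      x ≤ ((max (CompositeQHT.affineDim (CompositeQHT.copies n D₁))
          (CompositeQHT.affineDim (CompositeQHT.copies n D₂)) : ℕ) + 1 : ℝ) *
        CompositeQHT.supFidelity D₁ D₂ ^ n := by
    obtain ⟨ρ, hρ, σ, hσ, rfl⟩ := hx
    exact CompositeQHT.fidelity_hullCopies_le hD₁ hD₂ hρ hσ
  -- Nonnegativity of the bound covers the empty supremum, which is 0.
  have h0 := CompositeQHT.supFidelity_nonneg D₁ D₂
  exact ⟨CompositeQHT.bddAbove_fidelityValues hD₁ hD₂, ⟨_, fun _ => hF⟩,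
    Real.sSup_le (fun _ => hF) (by positivity),
    CompositeQHT.affineDim_copies_add_one_le n hd hD₁,
    CompositeQHT.affineDim_copies_add_one_le n hd hD₂,
    CompositeQHT.finrank_permInvariant d n⟩
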